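/- Let $n\ge 4$ be an integer and, for $\rho\in\mathbb{R}$, let $$\Phi(\rho)=\int_{-1}^{1}\frac{\left|t-\frac{n-2}{n}\rho\right|\,(1-t^2)^{\frac{n-3}{2}}}{(1-2t\rho+\rho^2)^{\frac{n-2}{2}}}\,dt .$$ The integral converges for every $\rho\in[0,1]$, and $\Phi$ is strictly concave on the interval $(0,1)$. Moreover $\Phi'(0)=0$, the function $\Phi$ is strictly decreasing on $[0,1]$, and $\max_{\rho\in[0,1]}\Phi(\rho)=\Phi(0)=\frac{2}{n-1}$. -/

import Mathlib

/-- The integrand `|t - (n-2)/n * ρ| (1 - t²)^((n-3)/2) / (1 - 2tρ + ρ²)^((n-2)/2)`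
of the function `Φ`; all operations, in particular the subtractions and the divisions
`n - 2`, `(n-2)/n`, `(n-3)/2`, `(n-2)/2`, are those of the real numbers. -/
noncomputable def phiIntegrand (n : ℕ) (ρ t : ℝ) : ℝ :=
  |t - ((n : ℝ) - 2) / (n : ℝ) * ρ| * (1 - t ^ 2) ^ (((n : ℝ) - 3) / 2) /
    (1 - 2 * t * ρ + ρ ^ 2) ^ (((n : ℝ) - 2) / 2)

/-- The function `Φ(ρ) = ∫_{-1}^{1} |t - (n-2)/n ρ| (1-t²)^((n-3)/2) /
(1 - 2tρ + ρ²)^((n-2)/2) dt` in dimension `n`. -/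
noncomputable def Phi (n : ℕ) (ρ : ℝ) : ℝ :=
  ∫ t in (-1 : ℝ)..1, phiIntegrand n ρ t

open MeasureTheory Set intervalIntegral

/-- The Euler-type integral `∫₀¹ u^(s-1) (1 - uz)^(-1/2) du`. -/
noncomputable def eulerHalf (s z : ℝ) : ℝ :=
  ∫ u in (0 : ℝ)..1, u ^ (s - 1) * (1 - u * z) ^ (-(1 / 2) : ℝ)

/-- The derivative of `eulerHalf s` with respect to its argument. -/
noncomputable def eulerHalfDeriv (s z : ℝ) : ℝ :=
  ∫ u in (0 : ℝ)..1, u ^ (s - 1) * (u / 2 * (1 - u * z) ^ (-(3 / 2) : ℝ))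

theorem one_sub_mul_pos {u z : ℝ} (hu0 : 0 ≤ u) (hu1 : u ≤ 1) (hz : z < 1) : 0 < 1 - u * z := by
  rcases le_or_gt z 0 with h | h
  · nlinarith
  · nlinarith

theorem continuousOn_one_sub_mul_rpow {z : ℝ} (hz : z < 1) (r : ℝ) :
    ContinuousOn (fun u : ℝ => (1 - u * z) ^ r) (uIcc 0 1) := by
  rw [uIcc_of_le zero_le_one]
  intro u hu
  apply ContinuousAt.continuousWithinAt
  exact ContinuousAt.rpow_const (by fun_prop) (Or.inl (one_sub_mul_pos hu.1 hu.2 hz).ne')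

theorem continuous_rpow_sub_one {s : ℝ} (hs : 1 ≤ s) : Continuous fun u : ℝ => u ^ (s - 1) :=
  continuous_id.rpow_const fun _ => Or.inr (by linarith)

theorem continuousOn_eulerHalf_integrand {s z : ℝ} (hs : 1 ≤ s) (hz : z < 1) :
    ContinuousOn (fun u : ℝ => u ^ (s - 1) * (1 - u * z) ^ (-(1 / 2) : ℝ)) (uIcc 0 1) :=
  (continuous_rpow_sub_one hs).continuousOn.mul (continuousOn_one_sub_mul_rpow hz _)

theorem continuousOn_eulerHalfDeriv_integrand {s z : ℝ} (hs : 1 ≤ s) (hz : z < 1) :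
    ContinuousOn (fun u : ℝ => u ^ (s - 1) * (u / 2 * (1 - u * z) ^ (-(3 / 2) : ℝ)))
      (uIcc 0 1) :=
  (continuous_rpow_sub_one hs).continuousOn.mul
    ((by fun_prop : ContinuousOn (fun u : ℝ => u / 2) (uIcc 0 1)).mul
      (continuousOn_one_sub_mul_rpow hz _))

theorem hasDerivAt_eulerHalf {s z : ℝ} (hs : 1 ≤ s) (hz : z < 1) :
    HasDerivAt (eulerHalf s) (eulerHalfDeriv s z) z := by
  set δ : ℝ := min 1 ((1 - z) / 2) with hδ
  have hδ0 : 0 < δ := lt_min one_pos (by linarith)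
  have hball : Metric.ball z ((1 - z) / 2) ∈ nhds z := Metric.ball_mem_nhds _ (by linarith)
  have hlt : ∀ y ∈ Metric.ball z ((1 - z) / 2), y < 1 := by
    intro y hy
    rw [Metric.mem_ball, Real.dist_eq] at hy
    linarith [(abs_lt.1 hy).2]
  have hlow : ∀ y ∈ Metric.ball z ((1 - z) / 2), ∀ u ∈ Ioc (0 : ℝ) 1, δ ≤ 1 - u * y := by
    intro y hy u hu
    rw [Metric.mem_ball, Real.dist_eq] at hy
    have h1 := (abs_lt.1 hy).2
    rcases le_or_gt y 0 with h | h
    · exact (min_le_left _ _).trans (by nlinarith [hu.1])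
    · exact (min_le_right _ _).trans (by nlinarith [hu.2])
  have key := hasDerivAt_integral_of_dominated_loc_of_deriv_le (μ := volume) (a := 0) (b := 1)
    (F := fun y u : ℝ => u ^ (s - 1) * (1 - u * y) ^ (-(1 / 2) : ℝ))
    (F' := fun y u : ℝ => u ^ (s - 1) * (u / 2 * (1 - u * y) ^ (-(3 / 2) : ℝ)))
    (bound := fun _ => δ ^ (-(3 / 2) : ℝ)) (x₀ := z) hball ?_ ?_ ?_ ?_ ?_ ?_
  · exact key.2
  · filter_upwards [hball] with y hy
    have := (continuousOn_eulerHalf_integrand hs (hlt y hy)).mono uIoc_subset_uIcc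
    exact this.aestronglyMeasurable measurableSet_uIoc
  · exact (continuousOn_eulerHalf_integrand hs hz).intervalIntegrable
  · exact ((continuousOn_eulerHalfDeriv_integrand hs hz).mono
      uIoc_subset_uIcc).aestronglyMeasurable measurableSet_uIoc
  · refine Filter.Eventually.of_forall fun u hu y hy => ?_
    rw [uIoc_of_le zero_le_one] at hu
    have h1 := hlow y hy u hu
    have h2 : (1 - u * y) ^ (-(3 / 2) : ℝ) ≤ δ ^ (-(3 / 2) : ℝ) :=
      Real.rpow_le_rpow_of_nonpos hδ0 h1 (by norm_num)
    have h3 : 0 ≤ (1 - u * y) ^ (-(3 / 2) : ℝ) := Real.rpow_nonneg (hδ0.le.trans h1) _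
    have h4 : u ^ (s - 1) ≤ 1 := Real.rpow_le_one hu.1.le hu.2 (by linarith)
    have h5 : 0 ≤ u ^ (s - 1) := Real.rpow_nonneg hu.1.le _
    have h6 : u / 2 * (1 - u * y) ^ (-(3 / 2) : ℝ) ≤ (1 - u * y) ^ (-(3 / 2) : ℝ) :=
      mul_le_of_le_one_left h3 (by linarith [hu.2])
    have h7 : 0 ≤ u / 2 * (1 - u * y) ^ (-(3 / 2) : ℝ) :=
      mul_nonneg (by linarith [hu.1]) h3
    rw [Real.norm_of_nonneg (mul_nonneg h5 h7)]
    exact (mul_le_of_le_one_left h7 h4).trans (h6.trans h2)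
  · exact intervalIntegrable_const
  · refine Filter.Eventually.of_forall fun u hu y hy => ?_
    rw [uIoc_of_le zero_le_one] at hu
    have hpos : 0 < 1 - u * y := hδ0.trans_le (hlow y hy u hu)
    have h := ((((hasDerivAt_id y).const_mul u).const_sub 1).rpow_const
      (p := (-(1 / 2) : ℝ)) (Or.inl hpos.ne')).const_mul (u ^ (s - 1))
    refine h.congr_deriv ?_
    rw [show (-(1 / 2) - 1 : ℝ) = -(3 / 2) by norm_num]
    simp only [id]
    ring

theorem eulerHalf_ode {s z : ℝ} (hs : 1 ≤ s) (hz : z < 1) :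
    z * eulerHalfDeriv s z + s * eulerHalf s z = (1 - z) ^ (-(1 / 2) : ℝ) := by
  have i1 := (continuousOn_eulerHalf_integrand hs hz).intervalIntegrable (μ := volume)
  have i2 := (continuousOn_eulerHalfDeriv_integrand hs hz).intervalIntegrable (μ := volume)
  have hF := integral_eq_sub_of_hasDerivAt (a := 0) (b := 1)
    (f := fun u : ℝ => u ^ s * (1 - u * z) ^ (-(1 / 2) : ℝ))
    (f' := fun u : ℝ => z * (u ^ (s - 1) * (u / 2 * (1 - u * z) ^ (-(3 / 2) : ℝ))) +
      s * (u ^ (s - 1) * (1 - u * z) ^ (-(1 / 2) : ℝ))) ?_ ((i2.const_mul z).add (i1.const_mul s))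
  · rw [integral_add (i2.const_mul z) (i1.const_mul s), intervalIntegral.integral_const_mul,
      intervalIntegral.integral_const_mul] at hF
    unfold eulerHalf eulerHalfDeriv
    rw [hF, Real.zero_rpow (by linarith)]
    simp
  · intro u hu
    rw [uIcc_of_le zero_le_one] at hu
    have hpos := one_sub_mul_pos hu.1 hu.2 hz
    have h1 := Real.hasDerivAt_rpow_const (x := u) (p := s) (Or.inr hs)
    have h2 := ((((hasDerivAt_id u).mul_const z).const_sub 1).rpow_const
      (p := (-(1 / 2) : ℝ)) (Or.inl hpos.ne'))
    refine (h1.mul h2).congr_deriv ?_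
    have hu' : u ^ s = u ^ (s - 1) * u := by
      rcases hu.1.eq_or_lt with h | h
      · rw [← h, Real.zero_rpow (by linarith)]; simp
      · rw [Real.rpow_sub_one h.ne']; field_simp
    rw [show (-(1 / 2) - 1 : ℝ) = -(3 / 2) by norm_num, hu']
    simp only [id]
    ring

/-- An explicit primitive of `t ↦ (l/(l+1) ρ - t) (1 - t²)^(l-1/2) (1 - 2tρ + ρ²)^(-l)`. -/
noncomputable def gegenbauerPrimitive (l ρ t : ℝ) : ℝ :=
  (1 - t ^ 2) ^ (l + 1 / 2) * (1 - 2 * t * ρ + ρ ^ 2) ^ (-l) / (l + 1) -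
    l / (l + 1) * (1 - ρ ^ 2) / 2 * (((1 - t ^ 2) / (1 - 2 * t * ρ + ρ ^ 2)) ^ (l + 1 / 2) *
      eulerHalf (l + 1 / 2) (ρ ^ 2 * ((1 - t ^ 2) / (1 - 2 * t * ρ + ρ ^ 2))))

theorem kernel_pos {ρ t : ℝ} (ht : t ∈ Ioo (-1 : ℝ) 1) : 0 < 1 - 2 * t * ρ + ρ ^ 2 := by
  nlinarith [sq_nonneg (ρ - t), ht.1, ht.2, mul_pos (sub_pos.2 ht.1) (sub_pos.2 ht.2)]

theorem kernel_pos_of_abs_lt {ρ t : ℝ} (hρ : ρ ∈ Ioo (-1 : ℝ) 1) (ht : t ∈ Icc (-1 : ℝ) 1) :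
    0 < 1 - 2 * t * ρ + ρ ^ 2 := by
  nlinarith [hρ.1, hρ.2, ht.1, ht.2, sq_nonneg (ρ - t),
    mul_pos (sub_pos.2 hρ.1) (sub_pos.2 hρ.2), mul_nonneg (sub_nonneg.2 ht.1) (sub_nonneg.2 ht.2)]

theorem one_sub_sq_mul_ratio {ρ t : ℝ} (hP : 0 < 1 - 2 * t * ρ + ρ ^ 2) :
    1 - ρ ^ 2 * ((1 - t ^ 2) / (1 - 2 * t * ρ + ρ ^ 2)) =
      (1 - t * ρ) ^ 2 / (1 - 2 * t * ρ + ρ ^ 2) := by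
  rw [eq_div_iff hP.ne', sub_mul, mul_assoc (ρ ^ 2), div_mul_cancel₀ _ hP.ne']
  ring

theorem sq_div_rpow_neg_half {a b : ℝ} (ha : 0 < a) (hb : 0 < b) :
    (a ^ 2 / b) ^ (-(1 / 2) : ℝ) = √b / a := by
  rw [Real.rpow_neg (by positivity), ← Real.sqrt_eq_rpow, Real.sqrt_div (by positivity),
    Real.sqrt_sq ha.le, inv_div]

theorem hasDerivAt_gegenbauerPrimitive {l ρ t : ℝ} (hl : 1 ≤ l) (hρ : ρ ∈ Ioc (-1 : ℝ) 1)
    (ht : t ∈ Ioo (-1 : ℝ) 1) :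
    HasDerivAt (gegenbauerPrimitive l ρ)
      ((l / (l + 1) * ρ - t) *
        ((1 - t ^ 2) ^ (l - 1 / 2) * (1 - 2 * t * ρ + ρ ^ 2) ^ (-l))) t := by
  have hP := kernel_pos (ρ := ρ) ht
  have hW : 0 < 1 - t ^ 2 := by nlinarith [ht.1, ht.2]
  have hr : 0 < 1 - t * ρ := by
    rcases le_or_gt ρ 0 with h | h <;> nlinarith [ht.1, ht.2, hρ.1, hρ.2]
  set P : ℝ := 1 - 2 * t * ρ + ρ ^ 2 with hPdef
  have hκ : 0 < (1 - t ^ 2) / P := div_pos hW hP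
  have h1z := one_sub_sq_mul_ratio (ρ := ρ) (t := t) hP
  rw [← hPdef] at h1z
  have hz : ρ ^ 2 * ((1 - t ^ 2) / P) < 1 := by
    have : 0 < (1 - t * ρ) ^ 2 / P := by positivity
    linarith
  have hs : (1 : ℝ) ≤ l + 1 / 2 := by linarith
  have dW : HasDerivAt (fun y : ℝ => 1 - y ^ 2) (-(2 * t)) t := by
    simpa using (hasDerivAt_pow 2 t).const_sub 1
  have dP : HasDerivAt (fun y : ℝ => 1 - 2 * y * ρ + ρ ^ 2) (-(2 * ρ)) t := by
    have := ((((hasDerivAt_id t).const_mul 2).mul_const ρ).const_sub 1).add_const (ρ ^ 2)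
    simpa using this
  have dκ := dW.div dP hP.ne'
  have dWs := dW.rpow_const (p := l + 1 / 2) (Or.inl hW.ne')
  have dPl := dP.rpow_const (p := -l) (Or.inl hP.ne')
  have dκs := dκ.rpow_const (p := l + 1 / 2) (Or.inl hκ.ne')
  have db := (hasDerivAt_eulerHalf hs hz).comp t (dκ.const_mul (ρ ^ 2))
  have key := ((dWs.mul dPl).div_const (l + 1)).sub
    ((dκs.mul db).const_mul (l / (l + 1) * (1 - ρ ^ 2) / 2))
  refine HasDerivAt.congr_deriv (f := gegenbauerPrimitive l ρ) key ?_
  have ode := eulerHalf_ode hs hz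
  rw [h1z, sq_div_rpow_neg_half hr hP] at ode
  simp only [Pi.div_apply, Function.comp_apply]
  rw [← hPdef]
  set b := eulerHalf (l + 1 / 2) (ρ ^ 2 * ((1 - t ^ 2) / P))
  set b' := eulerHalfDeriv (l + 1 / 2) (ρ ^ 2 * ((1 - t ^ 2) / P))
  set Q := P ^ (-l) with hQ
  set w := (1 - t ^ 2) ^ (l - 1 / 2) with hw
  have e1 : (1 - t ^ 2) ^ (l + 1 / 2 - 1) = w := by rw [hw]; congr 1; ring
  have e2 : (1 - t ^ 2) ^ (l + 1 / 2) = w * (1 - t ^ 2) := by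
    rw [← e1, ← Real.rpow_add_one hW.ne']; congr 1; ring
  have e3 : P ^ (-l - 1) = Q / P := by rw [Real.rpow_sub_one hP.ne']
  have e4 : ((1 - t ^ 2) / P) ^ (l + 1 / 2 - 1) = w * Q * √P := by
    rw [Real.div_rpow hW.le hP.le, e1, hQ, Real.sqrt_eq_rpow, mul_assoc, ← Real.rpow_add hP,
      div_eq_mul_inv, ← Real.rpow_neg hP.le]
    congr 2; ring
  have e5 : ((1 - t ^ 2) / P) ^ (l + 1 / 2) = w * Q * √P * ((1 - t ^ 2) / P) := by
    rw [← e4, ← Real.rpow_add_one hκ.ne']; congr 1; ring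
  have hsq : √P * √P = P := Real.mul_self_sqrt hP.le
  rw [e1, e2, e3, e4, e5]
  have collect : ∀ κ' : ℝ,
      κ' * (l + 1 / 2) * (w * Q * √P) * b +
        w * Q * √P * ((1 - t ^ 2) / P) * (b' * (ρ ^ 2 * κ')) = κ' * (w * Q * (P / (1 - t * ρ))) := by
    intro κ'
    have : κ' * (l + 1 / 2) * (w * Q * √P) * b +
        w * Q * √P * ((1 - t ^ 2) / P) * (b' * (ρ ^ 2 * κ')) =
        κ' * (w * Q) * √P * (ρ ^ 2 * ((1 - t ^ 2) / P) * b' + (l + 1 / 2) * b) := by ring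
    rw [this, ode, ← mul_div_assoc, mul_assoc _ (√P), hsq]
    ring
  rw [collect]
  have hl1 : l + 1 ≠ 0 := by linarith
  have hκ' : (-(2 * t) * P - (1 - t ^ 2) * -(2 * ρ)) / P ^ 2 =
      2 * (ρ - t) * (1 - t * ρ) / P ^ 2 := by
    rw [hPdef]; ring
  rw [hκ']
  have hr' := hr.ne'
  have hP' := hP.ne'
  field_simp
  rw [hPdef]
  ring

/-- The function of `x = ρ²` that `Φ` is equal to, with `l = (n - 2) / 2`. -/
noncomputable def phiClosed (l x : ℝ) : ℝ :=
  2 / (l + 1) * ((1 - (l / (l + 1)) ^ 2 * x) ^ (l + 1 / 2) *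
      (1 + (1 - 2 * (l / (l + 1))) * x) ^ (-l)) -
    l / (l + 1) * (1 - x) *
      (((1 - (l / (l + 1)) ^ 2 * x) / (1 + (1 - 2 * (l / (l + 1))) * x)) ^ (l + 1 / 2) *
      eulerHalf (l + 1 / 2)
        (x * ((1 - (l / (l + 1)) ^ 2 * x) / (1 + (1 - 2 * (l / (l + 1))) * x))))

theorem two_mul_gegenbauerPrimitive (l ρ : ℝ) :
    2 * gegenbauerPrimitive l ρ (l / (l + 1) * ρ) = phiClosed l (ρ ^ 2) := by
  unfold gegenbauerPrimitive phiClosed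
  rw [show 1 - (l / (l + 1) * ρ) ^ 2 = 1 - (l / (l + 1)) ^ 2 * ρ ^ 2 by ring,
    show 1 - 2 * (l / (l + 1) * ρ) * ρ + ρ ^ 2 = 1 + (1 - 2 * (l / (l + 1))) * ρ ^ 2 by ring]
  ring

/-- The integral of `|t - a| g t` when a primitive of `(a - t) g t` vanishes at both ends. -/
theorem integral_abs_sub_mul {D g : ℝ → ℝ} {a : ℝ} (ha : a ∈ Icc (-1 : ℝ) 1)
    (hD : ContinuousOn D (Icc (-1) 1)) (h0 : D (-1) = 0) (h1 : D 1 = 0)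
    (hd : ∀ t ∈ Ioo (-1 : ℝ) 1, HasDerivAt D ((a - t) * g t) t)
    (hg : ∀ t ∈ Ioo (-1 : ℝ) 1, 0 ≤ g t) :
    IntervalIntegrable (fun t => |t - a| * g t) volume (-1) 1 ∧
      ∫ t in (-1 : ℝ)..1, |t - a| * g t = 2 * D a := by
  have cL : ContinuousOn D (Icc (-1) a) := hD.mono (Icc_subset_Icc_right ha.2)
  have cR : ContinuousOn (fun t => -D t) (Icc a 1) := (hD.mono (Icc_subset_Icc_left ha.1)).neg
  have dL : ∀ t ∈ Ioo (-1) a, HasDerivAt D (|t - a| * g t) t := fun t ht => by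
    rw [abs_of_neg (by linarith [ht.2]), neg_sub]
    exact hd t ⟨ht.1, ht.2.trans_le ha.2⟩
  have dR : ∀ t ∈ Ioo a 1, HasDerivAt (fun t => -D t) (|t - a| * g t) t := fun t ht => by
    rw [abs_of_pos (by linarith [ht.1])]
    exact (hd t ⟨ha.1.trans_lt ht.1, ht.2⟩).neg.congr_deriv (by ring)
  have iL : IntervalIntegrable (fun t => |t - a| * g t) volume (-1) a := by
    apply intervalIntegrable_deriv_of_nonneg (g := D)
    · rwa [uIcc_of_le ha.1]
    · rw [min_eq_left ha.1, max_eq_right ha.1]; exact dL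
    · rw [min_eq_left ha.1, max_eq_right ha.1]
      exact fun t ht => mul_nonneg (abs_nonneg _) (hg t ⟨ht.1, ht.2.trans_le ha.2⟩)
  have iR : IntervalIntegrable (fun t => |t - a| * g t) volume a 1 := by
    apply intervalIntegrable_deriv_of_nonneg (g := fun t => -D t)
    · rwa [uIcc_of_le ha.2]
    · rw [min_eq_left ha.2, max_eq_right ha.2]; exact dR
    · rw [min_eq_left ha.2, max_eq_right ha.2]
      exact fun t ht => mul_nonneg (abs_nonneg _) (hg t ⟨ha.1.trans_lt ht.1, ht.2⟩)
  refine ⟨iL.trans iR, ?_⟩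
  rw [← integral_add_adjacent_intervals iL iR,
    integral_eq_sub_of_hasDerivAt_of_le ha.1 cL dL iL,
    integral_eq_sub_of_hasDerivAt_of_le ha.2 cR dR iR, h0, h1]
  ring

theorem gegenbauerPrimitive_neg_one {l : ℝ} (hl : 1 ≤ l) (ρ : ℝ) :
    gegenbauerPrimitive l ρ (-1) = 0 := by
  have : l + 1 / 2 ≠ 0 := by linarith
  simp [gegenbauerPrimitive, Real.zero_rpow (by simpa using this)]

theorem gegenbauerPrimitive_one {l : ℝ} (hl : 1 ≤ l) (ρ : ℝ) :
    gegenbauerPrimitive l ρ 1 = 0 := by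
  have : l + 1 / 2 ≠ 0 := by linarith
  simp [gegenbauerPrimitive, Real.zero_rpow (by simpa using this)]

theorem continuousOn_gegenbauerPrimitive_of_abs_lt {l ρ : ℝ} (hl : 1 ≤ l)
    (hρ : ρ ∈ Ioo (-1 : ℝ) 1) : ContinuousOn (gegenbauerPrimitive l ρ) (Icc (-1) 1) := by
  have hP : ∀ t ∈ Icc (-1 : ℝ) 1, 0 < 1 - 2 * t * ρ + ρ ^ 2 :=
    fun t ht => kernel_pos_of_abs_lt hρ ht
  have cκ : ContinuousOn (fun t : ℝ => (1 - t ^ 2) / (1 - 2 * t * ρ + ρ ^ 2)) (Icc (-1) 1) :=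
    ContinuousOn.div (by fun_prop) (by fun_prop) fun t ht => (hP t ht).ne'
  have cb : ContinuousOn (eulerHalf (l + 1 / 2)) (Iio 1) := fun z hz =>
    (hasDerivAt_eulerHalf (by linarith) hz).continuousAt.continuousWithinAt
  have hmap : MapsTo (fun t : ℝ => ρ ^ 2 * ((1 - t ^ 2) / (1 - 2 * t * ρ + ρ ^ 2)))
      (Icc (-1) 1) (Iio 1) := by
    intro t ht
    have hr : 0 < 1 - t * ρ := by
      rcases le_or_gt ρ 0 with h | h <;> nlinarith [ht.1, ht.2, hρ.1, hρ.2]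
    have h := one_sub_sq_mul_ratio (hP t ht)
    have : 0 < (1 - t * ρ) ^ 2 / (1 - 2 * t * ρ + ρ ^ 2) := div_pos (by positivity) (hP t ht)
    rw [mem_Iio]
    linarith
  have hs : 0 ≤ l + 1 / 2 := by linarith
  unfold gegenbauerPrimitive
  refine ContinuousOn.sub (ContinuousOn.div_const (ContinuousOn.mul ?_ ?_) _)
    (ContinuousOn.mul continuousOn_const (ContinuousOn.mul ?_ ?_))
  · exact ContinuousOn.rpow_const (by fun_prop) fun t _ => Or.inr hs
  · exact ContinuousOn.rpow_const (by fun_prop) fun t ht => Or.inl (hP t ht).ne'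
  · exact cκ.rpow_const fun t _ => Or.inr hs
  · exact cb.comp (continuousOn_const.mul cκ) hmap

theorem continuousOn_gegenbauerPrimitive_one {l : ℝ} (hl : 1 ≤ l) :
    ContinuousOn (gegenbauerPrimitive l 1) (Icc (-1) 1) := by
  have hs : 0 ≤ l + 1 / 2 := by linarith
  have hc : ContinuousOn
      (fun t : ℝ => (1 + t) ^ (l + 1 / 2) * (1 - t) ^ (1 / 2 : ℝ) * 2 ^ (-l) / (l + 1))
      (Icc (-1) 1) := by
    refine ContinuousOn.div_const (ContinuousOn.mul (ContinuousOn.mul ?_ ?_) continuousOn_const) _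
    · exact ContinuousOn.rpow_const (by fun_prop) fun t _ => Or.inr hs
    · exact ContinuousOn.rpow_const (by fun_prop) fun t _ => Or.inr (by norm_num)
  refine hc.congr fun t ht => ?_
  rcases ht.2.eq_or_lt with h | h
  · rw [h, gegenbauerPrimitive_one hl]
    simp [Real.zero_rpow]
  · have h1 : 0 < 1 - t := by linarith
    have h2 : 0 ≤ 1 + t := by linarith [ht.1]
    have h3 : (1 - t) ^ (1 / 2 : ℝ) = (1 - t) ^ (l + 1 / 2) * (1 - t) ^ (-l) := by
      rw [← Real.rpow_add h1]; congr 1; ring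
    simp only [gegenbauerPrimitive]
    rw [show 1 - 2 * t * 1 + 1 ^ 2 = 2 * (1 - t) by ring,
      show 1 - t ^ 2 = (1 + t) * (1 - t) by ring, Real.mul_rpow h2 h1.le,
      Real.mul_rpow (by norm_num) h1.le, h3]
    ring

theorem phiIntegrand_eq {n : ℕ} (hn : 4 ≤ n) {l : ℝ} (hl : l = ((n : ℝ) - 2) / 2) (ρ : ℝ)
    {t : ℝ} (hP : 0 ≤ 1 - 2 * t * ρ + ρ ^ 2) :
    phiIntegrand n ρ t = |t - l / (l + 1) * ρ| *
      ((1 - t ^ 2) ^ (l - 1 / 2) * (1 - 2 * t * ρ + ρ ^ 2) ^ (-l)) := by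
  have hn' : (n : ℝ) ≠ 0 := by positivity
  have e1 : ((n : ℝ) - 2) / n = l / (l + 1) := by
    rw [hl, show ((n : ℝ) - 2) / 2 + 1 = n / 2 by ring]
    field_simp
  have e2 : ((n : ℝ) - 3) / 2 = l - 1 / 2 := by rw [hl]; ring
  rw [phiIntegrand, e1, e2, ← hl, Real.rpow_neg hP]
  ring

theorem intervalIntegrable_phiIntegrand_and_Phi_eq {n : ℕ} (hn : 4 ≤ n) {l : ℝ}
    (hl : l = ((n : ℝ) - 2) / 2) {ρ : ℝ} (hρ : ρ ∈ Ioc (-1 : ℝ) 1) :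
    IntervalIntegrable (phiIntegrand n ρ) volume (-1) 1 ∧ Phi n ρ = phiClosed l (ρ ^ 2) := by
  have hl1 : 1 ≤ l := by
    have : (4 : ℝ) ≤ n := by exact_mod_cast hn
    rw [hl]; linarith
  have hc0 : 0 ≤ l / (l + 1) := by positivity
  have hc1 : l / (l + 1) ≤ 1 := by rw [div_le_one (by linarith)]; linarith
  have hcont : ContinuousOn (gegenbauerPrimitive l ρ) (Icc (-1) 1) := by
    rcases hρ.2.eq_or_lt with h | h
    · rw [h]; exact continuousOn_gegenbauerPrimitive_one hl1
    · exact continuousOn_gegenbauerPrimitive_of_abs_lt hl1 ⟨hρ.1, h⟩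
  have key := integral_abs_sub_mul (D := gegenbauerPrimitive l ρ)
    (g := fun t => (1 - t ^ 2) ^ (l - 1 / 2) * (1 - 2 * t * ρ + ρ ^ 2) ^ (-l))
    (a := l / (l + 1) * ρ) ⟨by nlinarith [hρ.1, hρ.2], by nlinarith [hρ.1, hρ.2]⟩ hcont
    (gegenbauerPrimitive_neg_one hl1 ρ) (gegenbauerPrimitive_one hl1 ρ)
    (fun t ht => hasDerivAt_gegenbauerPrimitive hl1 hρ ht)
    (fun t ht => mul_nonneg (Real.rpow_nonneg (by nlinarith [ht.1, ht.2]) _)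
      (Real.rpow_nonneg (kernel_pos ht).le _))
  have hP : ∀ t ∈ Icc (-1 : ℝ) 1, 0 ≤ 1 - 2 * t * ρ + ρ ^ 2 := fun t ht => by
    nlinarith [sq_nonneg (ρ - t), mul_nonneg (sub_nonneg.2 ht.1) (sub_nonneg.2 ht.2)]
  rw [two_mul_gegenbauerPrimitive] at key
  constructor
  · refine key.1.congr fun t ht => ?_
    rw [uIoc_of_le (by norm_num)] at ht
    exact (phiIntegrand_eq hn hl ρ (hP t ⟨ht.1.le, ht.2⟩)).symm
  · rw [← key.2, Phi]
    refine integral_congr fun t ht => ?_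
    rw [uIcc_of_le (by norm_num)] at ht
    exact phiIntegrand_eq hn hl ρ (hP t ht)

/-- Numerator of the fifth convergent, in `w = 1 - z`, of Gauss's continued fraction of
`₂F₁(l + 1, 1; l + 3/2; z)`. -/
noncomputable def gaussNum (l w : ℝ) : ℝ :=
  (2 * l + 7) * (297 + 420 * l + 132 * l ^ 2 +
    (936 + 1372 * l + 656 * l ^ 2 + 112 * l ^ 3) * w +
    (252 + 392 * l + 308 * l ^ 2 + 112 * l ^ 3 + 16 * l ^ 4) * w ^ 2)

/-- Denominator of the fifth convergent, in `w = 1 - z`, of Gauss's continued fraction of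
`₂F₁(l + 1, 1; l + 3/2; z)`. -/
noncomputable def gaussDen (l w : ℝ) : ℝ :=
  (2 * l + 3) * (2 * l + 5) * (15 + (270 + 90 * l) * w + (360 + 300 * l + 60 * l ^ 2) * w ^ 2 +
    (48 + 88 * l + 48 * l ^ 2 + 8 * l ^ 3) * w ^ 3)

theorem gaussDen_pos {l w : ℝ} (hl : 0 ≤ l) (hw : 0 ≤ w) : 0 < gaussDen l w := by
  unfold gaussDen
  positivity

theorem hasDerivAt_gaussNum (l z : ℝ) :
    HasDerivAt (fun z => gaussNum l (1 - z))
      (-((2 * l + 7) * ((936 + 1372 * l + 656 * l ^ 2 + 112 * l ^ 3) +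
        (252 + 392 * l + 308 * l ^ 2 + 112 * l ^ 3 + 16 * l ^ 4) * (2 * (1 - z))))) z := by
  have h := (hasDerivAt_id z).const_sub 1
  have := (((h.const_mul (936 + 1372 * l + 656 * l ^ 2 + 112 * l ^ 3)).const_add
    (297 + 420 * l + 132 * l ^ 2)).add ((h.pow 2).const_mul
    (252 + 392 * l + 308 * l ^ 2 + 112 * l ^ 3 + 16 * l ^ 4))).const_mul (2 * l + 7)
  refine HasDerivAt.congr_deriv (f := fun z => gaussNum l (1 - z)) this ?_
  simp
  ring

theorem hasDerivAt_gaussDen (l z : ℝ) :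
    HasDerivAt (fun z => gaussDen l (1 - z))
      (-((2 * l + 3) * (2 * l + 5) * ((270 + 90 * l) +
        (360 + 300 * l + 60 * l ^ 2) * (2 * (1 - z)) +
        (48 + 88 * l + 48 * l ^ 2 + 8 * l ^ 3) * (3 * (1 - z) ^ 2)))) z := by
  have h := (hasDerivAt_id z).const_sub 1
  have := ((((h.const_mul (270 + 90 * l)).const_add 15).add ((h.pow 2).const_mul
    (360 + 300 * l + 60 * l ^ 2))).add ((h.pow 3).const_mul
    (48 + 88 * l + 48 * l ^ 2 + 8 * l ^ 3))).const_mul ((2 * l + 3) * (2 * l + 5))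
  refine HasDerivAt.congr_deriv (f := fun z => gaussDen l (1 - z)) this ?_
  simp
  ring

theorem gauss_convergent_identity (l z : ℝ) :
    (2 * l + 1) * gaussDen l (1 - z) ^ 2 -
        (2 * l + 1) * (1 - z) * gaussNum l (1 - z) * gaussDen l (1 - z) +
        z * gaussNum l (1 - z) * gaussDen l (1 - z) -
        2 * z * (1 - z) *
          (-((2 * l + 7) * ((936 + 1372 * l + 656 * l ^ 2 + 112 * l ^ 3) +
            (252 + 392 * l + 308 * l ^ 2 + 112 * l ^ 3 + 16 * l ^ 4) * (2 * (1 - z)))) *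
            gaussDen l (1 - z) -
          gaussNum l (1 - z) * -((2 * l + 3) * (2 * l + 5) * ((270 + 90 * l) +
            (360 + 300 * l + 60 * l ^ 2) * (2 * (1 - z)) +
            (48 + 88 * l + 48 * l ^ 2 + 8 * l ^ 3) * (3 * (1 - z) ^ 2)))) =
      5760 * (l + 1) * (l + 2) * (l + 3) * (2 * l + 3) * (2 * l + 5) * z ^ 6 := by
  unfold gaussNum gaussDen
  ring

theorem hasDerivAt_eulerHalf_sub_convergent {l z : ℝ} (hl : 1 ≤ l) (hz : z ∈ Ioo (0 : ℝ) 1) :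
    HasDerivAt (fun z => z ^ (l + 1 / 2) * (eulerHalf (l + 1 / 2) z -
        √(1 - z) * (gaussNum l (1 - z) / gaussDen l (1 - z) * (2 / (2 * l + 1)))))
      (z ^ (l - 1 / 2) / √(1 - z) *
        (5760 * (l + 1) * (l + 2) * (l + 3) * (2 * l + 3) * (2 * l + 5) * z ^ 6 /
          ((2 * l + 1) * gaussDen l (1 - z) ^ 2))) z := by
  have hw : 0 < 1 - z := sub_pos.2 hz.2
  have hs : (1 : ℝ) ≤ l + 1 / 2 := by linarith
  have hden := gaussDen_pos (l := l) (by linarith) hw.le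
  have dsq := ((hasDerivAt_id z).const_sub 1).sqrt hw.ne'
  have key := (Real.hasDerivAt_rpow_const (x := z) (p := l + 1 / 2) (Or.inl hz.1.ne')).mul
    ((hasDerivAt_eulerHalf hs hz.2).sub (dsq.mul
      (((hasDerivAt_gaussNum l z).div (hasDerivAt_gaussDen l z) hden.ne').mul_const
        (2 / (2 * l + 1)))))
  refine HasDerivAt.congr_deriv (f := fun z => z ^ (l + 1 / 2) * (eulerHalf (l + 1 / 2) z -
        √(1 - z) * (gaussNum l (1 - z) / gaussDen l (1 - z) * (2 / (2 * l + 1))))) key ?_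
  have ode := eulerHalf_ode hs hz.2
  rw [Real.rpow_neg hw.le, ← Real.sqrt_eq_rpow] at ode
  have hb : eulerHalfDeriv (l + 1 / 2) z =
      ((√(1 - z))⁻¹ - (l + 1 / 2) * eulerHalf (l + 1 / 2) z) / z := by
    rw [eq_div_iff hz.1.ne']; linarith
  have e1 : z ^ (l + 1 / 2 - 1) = z ^ (l - 1 / 2) := by congr 1; ring
  have e2 : z ^ (l + 1 / 2) = z ^ (l - 1 / 2) * z := by
    rw [← Real.rpow_add_one hz.1.ne']; congr 1; ring
  have hq : √(1 - z) ^ 2 = 1 - z := Real.sq_sqrt hw.le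
  have hq0 : 0 < √(1 - z) := Real.sqrt_pos.2 hw
  simp only [Pi.div_apply, Pi.mul_apply, Pi.sub_apply, id, hb, e1, e2]
  have hid := gauss_convergent_identity l z
  set N := gaussNum l (1 - z)
  set D := gaussDen l (1 - z)
  set N' := -((2 * l + 7) * ((936 + 1372 * l + 656 * l ^ 2 + 112 * l ^ 3) +
        (252 + 392 * l + 308 * l ^ 2 + 112 * l ^ 3 + 16 * l ^ 4) * (2 * (1 - z))))
  set D' := -((2 * l + 3) * (2 * l + 5) * ((270 + 90 * l) +
        (360 + 300 * l + 60 * l ^ 2) * (2 * (1 - z)) +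
        (48 + 88 * l + 48 * l ^ 2 + 8 * l ^ 3) * (3 * (1 - z) ^ 2)))
  set y := z ^ (l - 1 / 2)
  set b := eulerHalf (l + 1 / 2) z
  set r := √(1 - z)
  have h21 : 2 * l + 1 ≠ 0 := by linarith
  rw [← hid]
  clear_value N D N' D' y b
  clear hid key ode hb e1 e2
  have hz0 := hz.1.ne'
  have hr0 := hq0.ne'
  have hD := hden.ne'
  field_simp
  linear_combination (4 * y * z * (N * D' - D * N') - 2 * y * (2 * l + 1) * D * N) * hq

theorem convergent_lt_eulerHalf {l z : ℝ} (hl : 1 ≤ l) (hz : z ∈ Ioo (0 : ℝ) 1) :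
    √(1 - z) * (gaussNum l (1 - z) / gaussDen l (1 - z) * (2 / (2 * l + 1))) <
      eulerHalf (l + 1 / 2) z := by
  have hmono : StrictMonoOn (fun z => z ^ (l + 1 / 2) * (eulerHalf (l + 1 / 2) z -
      √(1 - z) * (gaussNum l (1 - z) / gaussDen l (1 - z) * (2 / (2 * l + 1)))))
      (Icc 0 z) := by
    apply strictMonoOn_of_deriv_pos (convex_Icc _ _)
    · intro y hy
      have hy1 : y < 1 := hy.2.trans_lt hz.2
      apply ContinuousAt.continuousWithinAt
      refine (continuousAt_id.rpow_const (Or.inr (by linarith))).mul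
        ((hasDerivAt_eulerHalf (by linarith) hy1).continuousAt.sub
        (ContinuousAt.mul ?_ (ContinuousAt.mul_const ?_ _)))
      · exact ContinuousAt.sqrt (by fun_prop)
      · exact (hasDerivAt_gaussNum l y).continuousAt.div (hasDerivAt_gaussDen l y).continuousAt
          (gaussDen_pos (by linarith) (by linarith)).ne'
    · intro y hy
      rw [interior_Icc] at hy
      have hy1 : y < 1 := hy.2.trans hz.2
      rw [(hasDerivAt_eulerHalf_sub_convergent hl ⟨hy.1, hy1⟩).deriv]
      have := gaussDen_pos (l := l) (w := 1 - y) (by linarith) (by linarith)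
      have h2 : 0 < √(1 - y) := Real.sqrt_pos.2 (by linarith)
      have h3 := hy.1
      positivity
  have h := hmono (left_mem_Icc.2 hz.1.le) (right_mem_Icc.2 hz.1.le) hz.1
  simp only [] at h
  rw [Real.zero_rpow (by linarith), zero_mul] at h
  have := pos_of_mul_pos_right h (Real.rpow_nonneg hz.1.le _)
  linarith

/-- The polynomial, with positive coefficients, that `-ρ² Φ''(ρ)` is bounded below by up to
positive factors, where `m = n / 2 - 2`, `x = ρ²` and `y = 1 - ρ²`. -/
noncomputable def concavityPoly (m x y : ℝ) : ℝ :=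
    (576576 + 5099008 * m + 16006192 * m ^ 2 + 27033296 * m ^ 3 + 28625404 * m ^ 4 + 20426680 * m
      ^ 5 + 10175557 * m ^ 6 + 3585085 * m ^ 7 + 889258 * m ^ 8 + 151672 * m ^ 9 + 16896 * m ^ 10
      + 1104 * m ^ 11 + 32 * m ^ 12) * y ^ 6 +
    (2559744 + 21540704 * m + 63206352 * m ^ 2 + 98901312 * m ^ 3 + 96299640 * m ^ 4 + 62706934 *
      m ^ 5 + 28262849 * m ^ 6 + 8918745 * m ^ 7 + 1956286 * m ^ 8 + 290000 * m ^ 9 + 27376 * m ^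
      10 + 1456 * m ^ 11 + 32 * m ^ 12) * x * y ^ 5 +
    (4733856 + 37850176 * m + 103127648 * m ^ 2 + 148017824 * m ^ 3 + 130716642 * m ^ 4 +
      76219248 * m ^ 5 + 30270647 * m ^ 6 + 8234439 * m ^ 7 + 1507302 * m ^ 8 + 176876 * m ^ 9 +
      11960 * m ^ 10 + 352 * m ^ 11) * x ^ 2 * y ^ 4 +
    (4669056 + 35407520 * m + 88909616 * m ^ 2 + 115759904 * m ^ 3 + 91312976 * m ^ 4 + 46683490
      * m ^ 5 + 15856999 * m ^ 6 + 3557731 * m ^ 7 + 506658 * m ^ 8 + 41460 * m ^ 9 + 1480 * m ^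
      10) * x ^ 3 * y ^ 3 +
    (2590560 + 18593392 * m + 42639936 * m ^ 2 + 49677084 * m ^ 3 + 34332358 * m ^ 4 + 14968976 *
      m ^ 5 + 4170364 * m ^ 6 + 720616 * m ^ 7 + 70192 * m ^ 8 + 2912 * m ^ 9) * x ^ 4 * y ^ 2 +
    (755712 + 5140112 * m + 10636720 * m ^ 2 + 10862860 * m ^ 3 + 6371660 * m ^ 4 + 2251888 * m ^
      5 + 471680 * m ^ 6 + 53120 * m ^ 7 + 2368 * m ^ 8) * x ^ 5 * y +
    (84240 + 552240 * m + 1004112 * m ^ 2 + 851312 * m ^ 3 + 385472 * m ^ 4 + 92928 * m ^ 5 +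
      10240 * m ^ 6 + 256 * m ^ 7) * x ^ 6

theorem concavityPoly_pos {m x y : ℝ} (hm : 0 ≤ m) (hx : 0 < x) (hy : 0 < y) :
    0 < concavityPoly m x y := by
  unfold concavityPoly
  positivity

/-- `gaussNum` in homogeneous form. -/
noncomputable def gaussNumHom (l W D : ℝ) : ℝ :=
  (2 * l + 7) * ((297 + 420 * l + 132 * l ^ 2) * D ^ 2 +
    (936 + 1372 * l + 656 * l ^ 2 + 112 * l ^ 3) * (W * D) +
    (252 + 392 * l + 308 * l ^ 2 + 112 * l ^ 3 + 16 * l ^ 4) * W ^ 2)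

/-- `gaussDen` in homogeneous form. -/
noncomputable def gaussDenHom (l W D : ℝ) : ℝ :=
  (2 * l + 3) * (2 * l + 5) * (15 * D ^ 3 + (270 + 90 * l) * (W * D ^ 2) +
    (360 + 300 * l + 60 * l ^ 2) * (W ^ 2 * D) +
    (48 + 88 * l + 48 * l ^ 2 + 8 * l ^ 3) * W ^ 3)

theorem gaussNum_div_gaussDen {l W D : ℝ} (hl : 0 ≤ l) (hW : 0 ≤ W) (hD : 0 < D) :
    gaussNum l (W / D) / gaussDen l (W / D) = D * gaussNumHom l W D / gaussDenHom l W D := by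
  have h1 : gaussNum l (W / D) = gaussNumHom l W D / D ^ 2 := by
    unfold gaussNum gaussNumHom; field_simp
  have h2 : gaussDen l (W / D) = gaussDenHom l W D / D ^ 3 := by
    unfold gaussDen gaussDenHom; field_simp
  have h3 : 0 < gaussDenHom l W D := by unfold gaussDenHom; positivity
  rw [h1, h2]
  field_simp

theorem concavity_identity (l x : ℝ) :
    ((2 * x * ((l ^ 2 * (l + 1) + 2 * l * (l + 1) ^ 2 - (l + 1) ^ 3) + 2 * l ^ 2 * (1 - l) * x) -
          (-(l + 1) ^ 3 + (l ^ 2 * (l + 1) + 2 * l * (l + 1) ^ 2 - (l + 1) ^ 3) * x +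
            l ^ 2 * (1 - l) * x ^ 2) +
          2 * ((l + 1 / 2) - (l - 1 / 2) * x) *
            ((l + 1) ^ 2 + l * (l + 1) * x - 2 * l ^ 2 * x) * (l + 1)) *
          ((l + 1) ^ 2 - l ^ 2 * x) * (1 + x + l * (1 - x)) +
        2 * x * (-(l + 1) ^ 3 + (l ^ 2 * (l + 1) + 2 * l * (l + 1) ^ 2 - (l + 1) ^ 3) * x +
            l ^ 2 * (1 - l) * x ^ 2) *
          (-(l - 1 / 2) * (l + 1) - 3 / 2 * (1 - l) * ((l + 1) ^ 2 - l ^ 2 * x))) *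
        gaussDenHom l ((1 + l - l * x) ^ 2) ((l + 1) * (1 + x + l * (1 - x))) * (2 * l + 1) +
      2 * (-(2 * (l + 1 / 2) + 1) * (l + 1 / 2) + (l - 1 / 2) * x * (2 * l)) *
        ((l + 1) ^ 2 - l ^ 2 * x) ^ 2 * (1 + x + l * (1 - x)) * (1 + l - l * x) *
        gaussNumHom l ((1 + l - l * x) ^ 2) ((l + 1) * (1 + x + l * (1 - x))) *
        ((l + 1) * (1 + x + l * (1 - x))) =
      -(x * ((l + 1) ^ 2 - l ^ 2 * x) * (1 + x + l * (1 - x)) ^ 2 * (l + 1) *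
        concavityPoly (l - 1) x (1 - x)) := by
  unfold gaussNumHom gaussDenHom concavityPoly
  ring

theorem concavity_inequality {l c x : ℝ} (hl : 1 ≤ l) (hc : c = l / (l + 1))
    (hx : x ∈ Ioo (0 : ℝ) 1) :
    (2 * x * ((c ^ 2 + 2 * c - 1) + 2 * c ^ 2 * (1 - 2 * c) * x) +
        2 * x * (-1 + (c ^ 2 + 2 * c - 1) * x + c ^ 2 * (1 - 2 * c) * x ^ 2) *
          (-((l - 1 / 2) * (1 - c) ^ 2) / ((1 - c ^ 2 * x) * (1 + (1 - 2 * c) * x)) -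
            3 / 2 * (1 - 2 * c) / (1 + (1 - 2 * c) * x)) +
        2 * ((l + 1 / 2) - (l - 1 / 2) * x) * (1 + c * x - 2 * c ^ 2 * x) -
        (-1 + (c ^ 2 + 2 * c - 1) * x + c ^ 2 * (1 - 2 * c) * x ^ 2)) +
      (-(2 * (l + 1 / 2) + 1) * (l + 1 / 2) + (l - 1 / 2) * x * (2 * l)) *
        ((1 - c ^ 2 * x) * (1 - c * x) *
          (gaussNum l ((1 - c * x) ^ 2 / (1 + (1 - 2 * c) * x)) /
            gaussDen l ((1 - c * x) ^ 2 / (1 + (1 - 2 * c) * x)) * (2 / (2 * l + 1)))) < 0 := by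
  have hl1 : 0 < l + 1 := by linarith
  have hx0 := hx.1
  have hx1 : 0 < 1 - x := sub_pos.2 hx.2
  have hl0 : 0 < l := by linarith
  have hT := concavityPoly_pos (m := l - 1) (x := x) (y := 1 - x) (by linarith) hx.1 hx1
  have hid := concavity_identity l x
  have hP : 0 < 1 + x + l * (1 - x) := by positivity
  have hU : 0 < 1 + l - l * x := by nlinarith
  have hV : 0 < (l + 1) ^ 2 - l ^ 2 * x := by nlinarith [sq_nonneg l]
  have eP : 1 + (1 - 2 * c) * x = (1 + x + l * (1 - x)) / (l + 1) := by
    rw [hc]; field_simp; ring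
  have eU : 1 - c * x = (1 + l - l * x) / (l + 1) := by rw [hc]; field_simp; ring
  have eV : 1 - c ^ 2 * x = ((l + 1) ^ 2 - l ^ 2 * x) / (l + 1) ^ 2 := by rw [hc]; field_simp
  have ew : ((1 + l - l * x) / (l + 1)) ^ 2 / ((1 + x + l * (1 - x)) / (l + 1)) =
      (1 + l - l * x) ^ 2 / ((l + 1) * (1 + x + l * (1 - x))) := by field_simp
  have eα : -1 + (c ^ 2 + 2 * c - 1) * x + c ^ 2 * (1 - 2 * c) * x ^ 2 =
      (-(l + 1) ^ 3 + (l ^ 2 * (l + 1) + 2 * l * (l + 1) ^ 2 - (l + 1) ^ 3) * x +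
            l ^ 2 * (1 - l) * x ^ 2) / (l + 1) ^ 3 := by rw [hc]; field_simp; ring
  have eα' : (c ^ 2 + 2 * c - 1) + 2 * c ^ 2 * (1 - 2 * c) * x =
      ((l ^ 2 * (l + 1) + 2 * l * (l + 1) ^ 2 - (l + 1) ^ 3) + 2 * l ^ 2 * (1 - l) * x) /
        (l + 1) ^ 3 := by rw [hc]; field_simp; ring
  have eq : 1 + c * x - 2 * c ^ 2 * x =
      ((l + 1) ^ 2 + l * (l + 1) * x - 2 * l ^ 2 * x) / (l + 1) ^ 2 := by
    rw [hc]; field_simp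
  have ed : (1 - c) ^ 2 = 1 / (l + 1) ^ 2 := by rw [hc]; field_simp; ring
  have eh : 1 - 2 * c = (1 - l) / (l + 1) := by rw [hc]; field_simp; ring
  have hQ : 0 < gaussDenHom l ((1 + l - l * x) ^ 2) ((l + 1) * (1 + x + l * (1 - x))) := by
    unfold gaussDenHom; positivity
  rw [eα, eα', eq, ed, eP, eU, eV, ew, eh,
    gaussNum_div_gaussDen hl0.le (sq_nonneg _) (mul_pos hl1 hP)]
  set P := 1 + x + l * (1 - x)
  set U := 1 + l - l * x
  set V := (l + 1) ^ 2 - l ^ 2 * x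
  set Q := gaussDenHom l (U ^ 2) ((l + 1) * P)
  set N := gaussNumHom l (U ^ 2) ((l + 1) * P)
  set T := concavityPoly (l - 1) x (1 - x)
  set α := -(l + 1) ^ 3 + (l ^ 2 * (l + 1) + 2 * l * (l + 1) ^ 2 - (l + 1) ^ 3) * x +
            l ^ 2 * (1 - l) * x ^ 2
  set α' := (l ^ 2 * (l + 1) + 2 * l * (l + 1) ^ 2 - (l + 1) ^ 3) + 2 * l ^ 2 * (1 - l) * x
  set q := (l + 1) ^ 2 + l * (l + 1) * x - 2 * l ^ 2 * x
  have h21 : 0 < 2 * l + 1 := by linarith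
  have hneg : -(x * V * P ^ 2 * (l + 1) * T) / ((l + 1) ^ 3 * V * P * Q * (2 * l + 1)) < 0 :=
    div_neg_of_neg_of_pos (neg_lt_zero.2 (by positivity)) (by positivity)
  refine lt_of_eq_of_lt ?_ hneg
  rw [← hid]
  clear_value P U V Q N T α α' q
  clear hid eP eU eV ew eα eα' eq ed eh hneg hc
  have hP' := hP.ne'
  have hV' := hV.ne'
  have hQ' := hQ.ne'
  have hl' := hl1.ne'
  have h21' := h21.ne'
  field_simp
  ring

/-- The ratio `(1 - t²) / (1 - 2tρ + ρ²)` at `t = cρ`, as a function of `x = ρ²`. -/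
noncomputable def nodeRatio (c x : ℝ) : ℝ := (1 - c ^ 2 * x) / (1 + (1 - 2 * c) * x)

/-- The algebraic factor of the derivatives of `phiClosed`. -/
noncomputable def nodePower (l c x : ℝ) : ℝ :=
  nodeRatio c x ^ (l - 1 / 2) * (1 + (1 - 2 * c) * x) ^ (-(3 / 2) : ℝ)

/-- The transcendental factor of `phiClosed`. -/
noncomputable def nodeBeta (l c x : ℝ) : ℝ :=
  nodeRatio c x ^ (l + 1 / 2) * eulerHalf (l + 1 / 2) (x * nodeRatio c x)

section
variable {l c x : ℝ}

theorem node_kernel_pos (hc0 : 0 ≤ c) (hc1 : c < 1) (hx : x ∈ Icc (0 : ℝ) 1) :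
    0 < 1 + (1 - 2 * c) * x := by
  nlinarith [hx.1, hx.2, mul_nonneg hx.1 (sub_nonneg.2 hc1.le)]

theorem node_weight_pos (hc0 : 0 ≤ c) (hc1 : c < 1) (hx : x ∈ Icc (0 : ℝ) 1) :
    0 < 1 - c ^ 2 * x := by
  have : c ^ 2 < 1 := by nlinarith
  nlinarith [hx.1, hx.2, sq_nonneg c]

theorem node_one_sub_pos (hc0 : 0 ≤ c) (hc1 : c < 1) (hx : x ∈ Icc (0 : ℝ) 1) :
    0 < 1 - c * x := by
  nlinarith [hx.1, hx.2]

theorem nodeRatio_pos (hc0 : 0 ≤ c) (hc1 : c < 1) (hx : x ∈ Icc (0 : ℝ) 1) :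
    0 < nodeRatio c x :=
  div_pos (node_weight_pos hc0 hc1 hx) (node_kernel_pos hc0 hc1 hx)

theorem one_sub_mul_nodeRatio (hp : 1 + (1 - 2 * c) * x ≠ 0) :
    1 - x * nodeRatio c x = (1 - c * x) ^ 2 / (1 + (1 - 2 * c) * x) := by
  rw [nodeRatio, eq_div_iff hp, sub_mul, mul_assoc x, div_mul_cancel₀ _ hp]
  ring

theorem mul_nodeRatio_lt_one (hc0 : 0 ≤ c) (hc1 : c < 1) (hx : x ∈ Icc (0 : ℝ) 1) :
    x * nodeRatio c x < 1 := by
  have h := one_sub_mul_nodeRatio (node_kernel_pos hc0 hc1 hx).ne'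
  have h2 := div_pos (pow_pos (node_one_sub_pos hc0 hc1 hx) 2) (node_kernel_pos hc0 hc1 hx)
  linarith

theorem hasDerivAt_node_kernel (c x : ℝ) :
    HasDerivAt (fun x => 1 + (1 - 2 * c) * x) (1 - 2 * c) x := by
  simpa using ((hasDerivAt_id x).const_mul (1 - 2 * c)).const_add 1

theorem hasDerivAt_nodeRatio (hp : 1 + (1 - 2 * c) * x ≠ 0) :
    HasDerivAt (nodeRatio c) (-(1 - c) ^ 2 / (1 + (1 - 2 * c) * x) ^ 2) x := by
  have h : HasDerivAt (fun x => 1 - c ^ 2 * x) (-c ^ 2) x := by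
    simpa using ((hasDerivAt_id x).const_mul (c ^ 2)).const_sub 1
  refine HasDerivAt.congr_deriv (f := nodeRatio c) (h.div (hasDerivAt_node_kernel c x) hp) ?_
  congr 1
  ring

theorem hasDerivAt_nodePower (hc0 : 0 ≤ c) (hc1 : c < 1) (hx : x ∈ Icc (0 : ℝ) 1) :
    HasDerivAt (nodePower l c) (nodePower l c x *
      (-((l - 1 / 2) * (1 - c) ^ 2) / ((1 - c ^ 2 * x) * (1 + (1 - 2 * c) * x)) -
            3 / 2 * (1 - 2 * c) / (1 + (1 - 2 * c) * x))) x := by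
  have hp := node_kernel_pos hc0 hc1 hx
  have hk := nodeRatio_pos hc0 hc1 hx
  have hV := node_weight_pos hc0 hc1 hx
  have := ((hasDerivAt_nodeRatio hp.ne').rpow_const (p := l - 1 / 2) (Or.inl hk.ne')).mul
    ((hasDerivAt_node_kernel c x).rpow_const (p := (-(3 / 2) : ℝ)) (Or.inl hp.ne'))
  refine HasDerivAt.congr_deriv (f := nodePower l c) this ?_
  rw [nodePower, Real.rpow_sub_one hk.ne', Real.rpow_sub_one hp.ne']
  set y := nodeRatio c x ^ (l - 1 / 2)
  rw [nodeRatio]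
  set p := 1 + (1 - 2 * c) * x
  set z := p ^ (-(3 / 2) : ℝ)
  have hp' := hp.ne'
  have hV' := hV.ne'
  field_simp
  ring

theorem hasDerivAt_nodeBeta (hl : 1 ≤ l) (hc0 : 0 ≤ c) (hc1 : c < 1) (hx : x ∈ Ioc (0 : ℝ) 1) :
    HasDerivAt (nodeBeta l c) ((-(l + 1 / 2) * nodeBeta l c x +
      nodePower l c x * (1 + c * x - 2 * c ^ 2 * x)) / x) x := by
  have hx' := Ioc_subset_Icc_self hx
  have hp := node_kernel_pos hc0 hc1 hx'
  have hk := nodeRatio_pos hc0 hc1 hx'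
  have hV := node_weight_pos hc0 hc1 hx'
  have hU := node_one_sub_pos hc0 hc1 hx'
  have hz := mul_nodeRatio_lt_one hc0 hc1 hx'
  have hs : 1 ≤ l + 1 / 2 := by linarith
  have dk := hasDerivAt_nodeRatio (c := c) hp.ne'
  have := (dk.rpow_const (p := l + 1 / 2) (Or.inl hk.ne')).mul
    ((hasDerivAt_eulerHalf hs hz).comp x ((hasDerivAt_id x).mul dk))
  refine HasDerivAt.congr_deriv (f := nodeBeta l c) this ?_
  have ode := eulerHalf_ode hs hz
  rw [one_sub_mul_nodeRatio hp.ne', sq_div_rpow_neg_half hU hp] at ode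
  have hb : eulerHalfDeriv (l + 1 / 2) (x * nodeRatio c x) =
      (√(1 + (1 - 2 * c) * x) / (1 - c * x) -
        (l + 1 / 2) * eulerHalf (l + 1 / 2) (x * nodeRatio c x)) / (x * nodeRatio c x) := by
    rw [eq_div_iff (mul_pos hx.1 hk).ne']; linarith
  have e1 : nodeRatio c x ^ (l + 1 / 2 - 1) = nodeRatio c x ^ (l - 1 / 2) := by congr 1; ring
  have e2 : nodeRatio c x ^ (l + 1 / 2) = nodeRatio c x ^ (l - 1 / 2) * nodeRatio c x := by
    rw [← Real.rpow_add_one hk.ne']; congr 1; ring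
  have e3 : (1 + (1 - 2 * c) * x) ^ (-(3 / 2) : ℝ) =
      √(1 + (1 - 2 * c) * x) / (1 + (1 - 2 * c) * x) ^ 2 := by
    rw [Real.sqrt_eq_rpow, ← Real.rpow_natCast, ← Real.rpow_sub hp]; norm_num
  simp only [Function.comp_apply, Pi.mul_apply, id]
  rw [hb, nodeBeta, nodePower, e1, e2, e3]
  set y := nodeRatio c x ^ (l - 1 / 2)
  set b := eulerHalf (l + 1 / 2) (x * nodeRatio c x)
  clear_value y b
  rw [nodeRatio]
  set r := √(1 + (1 - 2 * c) * x)
  clear_value r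
  have hp' := hp.ne'
  have hV' := hV.ne'
  have hU' := hU.ne'
  have hx0 := hx.1.ne'
  field_simp
  ring

theorem nodePower_eq (hc0 : 0 ≤ c) (hc1 : c < 1) (hx : x ∈ Icc (0 : ℝ) 1) :
    (1 - c ^ 2 * x) ^ (l + 1 / 2) * (1 + (1 - 2 * c) * x) ^ (-l) =
      (1 - c ^ 2 * x) * (1 + (1 - 2 * c) * x) * nodePower l c x := by
  have hp := node_kernel_pos hc0 hc1 hx
  have hV := node_weight_pos hc0 hc1 hx
  have e1 : (1 - c ^ 2 * x) ^ (l + 1 / 2) = (1 - c ^ 2 * x) ^ (l - 1 / 2) * (1 - c ^ 2 * x) := by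
    rw [← Real.rpow_add_one hV.ne']; congr 1; ring
  have e2 : (1 + (1 - 2 * c) * x) ^ (-l) = (1 + (1 - 2 * c) * x) ^ (-(l - 1 / 2)) *
      (1 + (1 - 2 * c) * x) ^ (-(3 / 2) : ℝ) * (1 + (1 - 2 * c) * x) := by
    rw [← Real.rpow_add hp, ← Real.rpow_add_one hp.ne']; congr 1; ring
  rw [nodePower, nodeRatio, Real.div_rpow hV.le hp.le, e1, e2, Real.rpow_neg hp.le (l - 1 / 2)]
  ring

end

theorem phiClosed_eq {l c x : ℝ} (hl : 1 ≤ l) (hc : c = l / (l + 1)) (hx : x ∈ Icc (0 : ℝ) 1) :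
    phiClosed l x = 2 * (1 - c) * ((1 - c ^ 2 * x) * (1 + (1 - 2 * c) * x)) * nodePower l c x -
      c * (1 - x) * nodeBeta l c x := by
  have hc0 : 0 ≤ c := by rw [hc]; positivity
  have hc1 : c < 1 := by rw [hc, div_lt_one (by linarith)]; linarith
  have hd : 2 / (l + 1) = 2 * (1 - c) := by
    have : l + 1 ≠ 0 := by linarith
    rw [hc]; field_simp; ring
  rw [phiClosed, hd, ← hc, nodePower_eq hc0 hc1 hx, nodeBeta, nodeRatio]
  ring

/-- `x ↦ x (d/dx) phiClosed l x`, up to the factor `c`. -/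
noncomputable def phiSlope (l c x : ℝ) : ℝ :=
  (-1 + (c ^ 2 + 2 * c - 1) * x + c ^ 2 * (1 - 2 * c) * x ^ 2) * nodePower l c x +
    ((l + 1 / 2) - (l - 1 / 2) * x) * nodeBeta l c x

theorem hasDerivAt_phiClosed {l c x : ℝ} (hl : 1 ≤ l) (hc : c = l / (l + 1))
    (hx : x ∈ Ioo (0 : ℝ) 1) : HasDerivAt (phiClosed l) (c * phiSlope l c x / x) x := by
  have hl1 : l + 1 ≠ 0 := by linarith
  have hc0 : 0 ≤ c := by rw [hc]; positivity
  have hc1 : c < 1 := by rw [hc, div_lt_one (by linarith)]; linarith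
  have hx' := Ioo_subset_Icc_self hx
  have hp := (node_kernel_pos hc0 hc1 hx').ne'
  have hV := (node_weight_pos hc0 hc1 hx').ne'
  have dV : HasDerivAt (fun x => 1 - c ^ 2 * x) (-c ^ 2) x := by
    simpa using ((hasDerivAt_id x).const_mul (c ^ 2)).const_sub 1
  have key := (((dV.mul (hasDerivAt_node_kernel c x)).const_mul (2 * (1 - c))).mul
    (hasDerivAt_nodePower (l := l) hc0 hc1 hx')).sub
    ((((hasDerivAt_id x).const_sub 1).const_mul c).mul
      (hasDerivAt_nodeBeta hl hc0 hc1 (Ioo_subset_Ioc_self hx)))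
  have hev : phiClosed l =ᶠ[nhds x] fun x =>
      2 * (1 - c) * ((1 - c ^ 2 * x) * (1 + (1 - 2 * c) * x)) * nodePower l c x -
      c * (1 - x) * nodeBeta l c x := by
    filter_upwards [Ioo_mem_nhds hx.1 hx.2] with y hy
    exact phiClosed_eq hl hc (Ioo_subset_Icc_self hy)
  refine HasDerivAt.congr_of_eventuallyEq (HasDerivAt.congr_deriv
    (f := fun x => 2 * (1 - c) * ((1 - c ^ 2 * x) * (1 + (1 - 2 * c) * x)) * nodePower l c x -
      c * (1 - x) * nodeBeta l c x) key ?_) hev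
  simp only [Pi.mul_apply, id]
  rw [phiSlope]
  have hcl : (1 - c) * l = c := by rw [hc]; field_simp; ring
  set e := nodePower l c x
  set b := nodeBeta l c x
  have hx0 := hx.1.ne'
  set p := 1 + (1 - 2 * c) * x with hpd
  set V := 1 - c ^ 2 * x with hVd
  have e1 : V * p * (e * (-((l - 1 / 2) * (1 - c) ^ 2) / (V * p) - 3 / 2 * (1 - 2 * c) / p)) =
      e * (-((l - 1 / 2) * (1 - c) ^ 2) - 3 / 2 * (1 - 2 * c) * V) := by
    field_simp
  rw [mul_assoc (2 * (1 - c)) (V * p), e1, eq_div_iff hx0]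
  have e2 : c * -1 * b + c * (1 - x) * ((-(l + 1 / 2) * b +
      e * (1 + c * x - 2 * c ^ 2 * x)) / x) = (c * -1 * b * x + c * (1 - x) * (-(l + 1 / 2) * b +
      e * (1 + c * x - 2 * c ^ 2 * x))) / x := by
    field_simp
  rw [e2, sub_mul, div_mul_cancel₀ _ hx0, hpd, hVd]
  linear_combination (-2 * (1 - c) ^ 2 * e * x) * hcl

theorem hasDerivAt_phiSlope {l c x : ℝ} (hl : 1 ≤ l) (hc0 : 0 ≤ c) (hc1 : c < 1)
    (hx : x ∈ Ioo (0 : ℝ) 1) : HasDerivAt (phiSlope l c)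
      (((c ^ 2 + 2 * c - 1) + 2 * c ^ 2 * (1 - 2 * c) * x) * nodePower l c x +
        (-1 + (c ^ 2 + 2 * c - 1) * x + c ^ 2 * (1 - 2 * c) * x ^ 2) * (nodePower l c x *
          (-((l - 1 / 2) * (1 - c) ^ 2) / ((1 - c ^ 2 * x) * (1 + (1 - 2 * c) * x)) -
            3 / 2 * (1 - 2 * c) / (1 + (1 - 2 * c) * x))) +
        (-(l - 1 / 2) * nodeBeta l c x + ((l + 1 / 2) - (l - 1 / 2) * x) *
          ((-(l + 1 / 2) * nodeBeta l c x +
            nodePower l c x * (1 + c * x - 2 * c ^ 2 * x)) / x))) x := by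
  have h1 := (((hasDerivAt_id x).const_mul (c ^ 2 + 2 * c - 1)).const_add (-1)).add
    ((hasDerivAt_pow 2 x).const_mul (c ^ 2 * (1 - 2 * c)))
  have h2 := ((hasDerivAt_id x).const_mul (l - 1 / 2)).const_sub (l + 1 / 2)
  have key := (h1.mul (hasDerivAt_nodePower (l := l) hc0 hc1 (Ioo_subset_Icc_self hx))).add
    (h2.mul (hasDerivAt_nodeBeta hl hc0 hc1 (Ioo_subset_Ioc_self hx)))
  refine HasDerivAt.congr_deriv (f := phiSlope l c) key ?_
  simp only [Pi.add_apply, id, Nat.cast_ofNat, Nat.add_one_sub_one, pow_one]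
  ring

/-- The sign of the second derivative of `ρ ↦ phiClosed l (ρ²)`. -/
theorem two_mul_deriv_phiSlope_lt {l c x : ℝ} (hl : 1 ≤ l) (hc : c = l / (l + 1))
    (hx : x ∈ Ioo (0 : ℝ) 1) : 2 * x * deriv (phiSlope l c) x < phiSlope l c x := by
  have hc0 : 0 ≤ c := by rw [hc]; positivity
  have hc1 : c < 1 := by rw [hc, div_lt_one (by linarith)]; linarith
  have hx' := Ioo_subset_Icc_self hx
  have hp := node_kernel_pos hc0 hc1 hx'
  have hk := nodeRatio_pos hc0 hc1 hx'
  have hV := node_weight_pos hc0 hc1 hx'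
  have hU := node_one_sub_pos hc0 hc1 hx'
  have hz := mul_nodeRatio_lt_one hc0 hc1 hx'
  have he : 0 < nodePower l c x := mul_pos (Real.rpow_pos_of_pos hk _) (Real.rpow_pos_of_pos hp _)
  have hG := convergent_lt_eulerHalf hl ⟨mul_pos hx.1 hk, hz⟩
  have hlow : nodePower l c x * ((1 - c ^ 2 * x) * (1 - c * x) *
      (gaussNum l ((1 - c * x) ^ 2 / (1 + (1 - 2 * c) * x)) /
        gaussDen l ((1 - c * x) ^ 2 / (1 + (1 - 2 * c) * x)) * (2 / (2 * l + 1)))) <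
      nodeBeta l c x := by
    have h := mul_lt_mul_of_pos_left hG (Real.rpow_pos_of_pos hk (l + 1 / 2))
    refine lt_of_eq_of_lt ?_ h
    have e2 : nodeRatio c x ^ (l + 1 / 2) = nodeRatio c x ^ (l - 1 / 2) * nodeRatio c x := by
      rw [← Real.rpow_add_one hk.ne']; congr 1; ring
    have e3 : (1 + (1 - 2 * c) * x) ^ (-(3 / 2) : ℝ) =
        (√(1 + (1 - 2 * c) * x) * (1 + (1 - 2 * c) * x))⁻¹ := by
      rw [Real.sqrt_eq_rpow, ← Real.rpow_add_one hp.ne', ← Real.rpow_neg hp.le]; norm_num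
    rw [one_sub_mul_nodeRatio hp.ne', Real.sqrt_div (sq_nonneg _), Real.sqrt_sq hU.le, e2,
      nodePower, e3, nodeRatio]
    have := Real.sqrt_pos.2 hp
    field_simp
  have hB : -(2 * (l + 1 / 2) + 1) * (l + 1 / 2) + (l - 1 / 2) * x * (2 * l) < 0 := by
    nlinarith [hx.1, hx.2, mul_nonneg (sub_nonneg.2 hl) (sub_nonneg.2 hx.2.le),
      mul_nonneg (mul_nonneg (sub_nonneg.2 hl) (sub_nonneg.2 hl)) (sub_nonneg.2 hx.2.le)]
  have hconc := concavity_inequality hl hc hx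
  have h1 := mul_lt_mul_of_neg_left hlow hB
  have h2 := mul_neg_of_pos_of_neg he hconc
  rw [(hasDerivAt_phiSlope hl hc0 hc1 hx).deriv]
  set e := nodePower l c x
  set b := nodeBeta l c x
  rw [phiSlope]
  change _ < _ * e + _ * b
  set G := (1 - c ^ 2 * x) * (1 - c * x) *
      (gaussNum l ((1 - c * x) ^ 2 / (1 + (1 - 2 * c) * x)) /
        gaussDen l ((1 - c * x) ^ 2 / (1 + (1 - 2 * c) * x)) * (2 / (2 * l + 1)))
  set E := -((l - 1 / 2) * (1 - c) ^ 2) / ((1 - c ^ 2 * x) * (1 + (1 - 2 * c) * x)) -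
            3 / 2 * (1 - 2 * c) / (1 + (1 - 2 * c) * x)
  have hx0 := hx.1.ne'
  have e4 : x * ((-(l + 1 / 2) * b + e * (1 + c * x - 2 * c ^ 2 * x)) / x) =
      -(l + 1 / 2) * b + e * (1 + c * x - 2 * c ^ 2 * x) := by field_simp
  set Y := (-(l + 1 / 2) * b + e * (1 + c * x - 2 * c ^ 2 * x)) / x
  have e5 : 2 * ((l + 1 / 2) - (l - 1 / 2) * x) * (x * Y) =
      2 * ((l + 1 / 2) - (l - 1 / 2) * x) *
        (-(l + 1 / 2) * b + e * (1 + c * x - 2 * c ^ 2 * x)) := by rw [e4]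
  clear_value e b G E Y
  linarith

theorem differentiableAt_phiClosed_zero {l : ℝ} (hl : 1 ≤ l) :
    DifferentiableAt ℝ (phiClosed l) 0 := by
  have h1 : DifferentiableAt ℝ (nodeRatio (l / (l + 1))) 0 :=
    (hasDerivAt_nodeRatio (by simp)).differentiableAt
  have h2 : DifferentiableAt ℝ (fun x => eulerHalf (l + 1 / 2) (x * nodeRatio (l / (l + 1)) x)) 0 :=
    DifferentiableAt.comp (g := eulerHalf (l + 1 / 2)) (0 : ℝ)
      (hasDerivAt_eulerHalf (by linarith) (by simp)).differentiableAt (differentiableAt_id.mul h1)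
  have h3 : DifferentiableAt ℝ (fun x => nodeRatio (l / (l + 1)) x ^ (l + 1 / 2)) 0 :=
    h1.rpow_const (Or.inl (by simp [nodeRatio]))
  unfold phiClosed
  refine DifferentiableAt.sub (DifferentiableAt.const_mul (DifferentiableAt.mul ?_ ?_) _)
    (DifferentiableAt.mul (by fun_prop) (h3.mul h2))
  · exact DifferentiableAt.rpow_const (by fun_prop) (Or.inl (by simp))
  · exact DifferentiableAt.rpow_const (by fun_prop) (Or.inl (by simp))

theorem continuousOn_phiClosed {l : ℝ} (hl : 1 ≤ l) : ContinuousOn (phiClosed l) (Icc 0 1) := by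
  have hc0 : 0 ≤ l / (l + 1) := by positivity
  have hc1 : l / (l + 1) < 1 := by rw [div_lt_one (by linarith)]; linarith
  intro x hx
  apply ContinuousAt.continuousWithinAt
  have hp := (node_kernel_pos hc0 hc1 hx).ne'
  have h1 : ContinuousAt (nodeRatio (l / (l + 1))) x := (hasDerivAt_nodeRatio hp).continuousAt
  have h2 : ContinuousAt (fun x => eulerHalf (l + 1 / 2) (x * nodeRatio (l / (l + 1)) x)) x :=
    ContinuousAt.comp (g := eulerHalf (l + 1 / 2))
      (hasDerivAt_eulerHalf (by linarith) (mul_nodeRatio_lt_one hc0 hc1 hx)).continuousAt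
      (continuousAt_id.mul h1)
  have h3 : ContinuousAt (fun x => nodeRatio (l / (l + 1)) x ^ (l + 1 / 2)) x :=
    h1.rpow_const (Or.inl (nodeRatio_pos hc0 hc1 hx).ne')
  unfold phiClosed
  refine ContinuousAt.sub (ContinuousAt.mul continuousAt_const (ContinuousAt.mul ?_ ?_))
    (ContinuousAt.mul (by fun_prop) (h3.mul h2))
  · exact ContinuousAt.rpow_const (by fun_prop) (Or.inl (node_weight_pos hc0 hc1 hx).ne')
  · exact ContinuousAt.rpow_const (by fun_prop) (Or.inl hp)

theorem phiClosed_zero {l : ℝ} (hl : 1 ≤ l) : phiClosed l 0 = 2 / (2 * l + 1) := by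
  have h := eulerHalf_ode (s := l + 1 / 2) (z := 0) (by linarith) one_pos
  have hb : eulerHalf (l + 1 / 2) 0 = 1 / (l + 1 / 2) := by
    rw [eq_div_iff (by linarith)]
    simpa [mul_comm] using h
  simp only [phiClosed, mul_zero, sub_zero, add_zero, Real.one_rpow, div_one, one_mul,
    mul_one, hb]
  have h1 : l + 1 ≠ 0 := by linarith
  have h2 : 2 * l + 1 ≠ 0 := by linarith
  have h3 : l + 1 / 2 ≠ 0 := by linarith
  field_simp
  ring

theorem hasDerivAt_phiClosed_sq {l ρ : ℝ} (hl : 1 ≤ l) (hρ : ρ ∈ Ioo (0 : ℝ) 1) :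
    HasDerivAt (fun ρ => phiClosed l (ρ ^ 2))
      (2 * (l / (l + 1)) * (phiSlope l (l / (l + 1)) (ρ ^ 2) / ρ)) ρ := by
  have hx : ρ ^ 2 ∈ Ioo (0 : ℝ) 1 := ⟨by have := hρ.1; positivity, by nlinarith [hρ.1, hρ.2]⟩
  refine (HasDerivAt.comp (h := fun ρ : ℝ => ρ ^ 2) ρ (hasDerivAt_phiClosed hl rfl hx)
    (hasDerivAt_pow 2 ρ)).congr_deriv ?_
  have := hρ.1.ne'
  push_cast
  field_simp

theorem strictConcaveOn_phiClosed_sq {l : ℝ} (hl : 1 ≤ l) :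
    StrictConcaveOn ℝ (Icc (0 : ℝ) 1) (fun ρ => phiClosed l (ρ ^ 2)) := by
  have hc0 : 0 < l / (l + 1) := by positivity
  have hc1 : l / (l + 1) < 1 := by rw [div_lt_one (by linarith)]; linarith
  refine strictConcaveOn_of_deriv2_neg (convex_Icc _ _) ?_ fun ρ hρ => ?_
  · refine (continuousOn_phiClosed hl).comp (by fun_prop) fun ρ hρ => ?_
    exact ⟨sq_nonneg _, by nlinarith [hρ.1, hρ.2]⟩
  · rw [interior_Icc] at hρ
    have hx : ρ ^ 2 ∈ Ioo (0 : ℝ) 1 := ⟨by have := hρ.1; positivity, by nlinarith [hρ.1, hρ.2]⟩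
    have hev : deriv (fun ρ => phiClosed l (ρ ^ 2)) =ᶠ[nhds ρ]
        fun ρ => 2 * (l / (l + 1)) * (phiSlope l (l / (l + 1)) (ρ ^ 2) / ρ) := by
      filter_upwards [Ioo_mem_nhds hρ.1 hρ.2] with y hy
      exact (hasDerivAt_phiClosed_sq hl hy).deriv
    have hd : HasDerivAt (phiSlope l (l / (l + 1)))
        (deriv (phiSlope l (l / (l + 1))) (ρ ^ 2)) (ρ ^ 2) :=
      (hasDerivAt_phiSlope hl hc0.le hc1 hx).differentiableAt.hasDerivAt
    have h2 := ((HasDerivAt.comp (h := fun ρ : ℝ => ρ ^ 2) ρ hd (hasDerivAt_pow 2 ρ)).div (hasDerivAt_id ρ)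
      hρ.1.ne').const_mul (2 * (l / (l + 1)))
    have hkey := two_mul_deriv_phiSlope_lt hl rfl hx
    rw [Function.iterate_succ, Function.iterate_one, Function.comp_apply, hev.deriv_eq]
    refine lt_of_eq_of_lt h2.deriv ?_
    refine mul_neg_of_pos_of_neg (by positivity) (div_neg_of_neg_of_pos ?_ (by
      have := hρ.1
      simp only [id]
      positivity))
    simp only [Function.comp_apply, id, Nat.cast_ofNat, Nat.add_one_sub_one, pow_one, mul_one]
    nlinarith

/-- A strictly concave function on an interval with zero derivative at the left end point is
strictly decreasing. -/
theorem StrictConcaveOn.strictAntiOn_of_hasDerivAt_zero {f : ℝ → ℝ} {a b : ℝ}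
    (hf : StrictConcaveOn ℝ (Icc a b) f) (h0 : HasDerivAt f 0 a) : StrictAntiOn f (Icc a b) := by
  have hlt : ∀ y ∈ Ioc a b, f y < f a := by
    intro y hy
    have ha : a ∈ Icc a b := ⟨le_rfl, hy.1.le.trans hy.2⟩
    set m := (a + y) / 2
    have ham : a < m := by simp only [m]; linarith [hy.1]
    have hmy : m < y := by simp only [m]; linarith [hy.1]
    have hm : m ∈ Icc a b := ⟨ham.le, hmy.le.trans hy.2⟩
    have h1 := hf.slope_anti_adjacent ha ⟨hy.1.le, hy.2⟩ ham hmy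
    have h2 := hf.concaveOn.slope_le_of_hasDerivAt ha hm ham h0
    rw [slope_def_field] at h2
    have h3 : f m ≤ f a := by
      rw [div_le_iff₀ (by linarith)] at h2; linarith
    have h4 := h1.trans_le h2
    rw [div_lt_iff₀ (by linarith)] at h4
    linarith
  intro x hx y hy hxy
  rcases hx.1.eq_or_lt with h | h
  · rw [← h]; exact hlt y ⟨h ▸ hxy, hy.2⟩
  · have h1 := hf.slope_anti_adjacent (left_mem_Icc.2 (hx.1.trans hx.2)) hy h hxy
    have h2 : (f x - f a) / (x - a) < 0 :=
      div_neg_of_neg_of_pos (by linarith [hlt x ⟨h, hx.2⟩]) (by linarith)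
    have h3 := h1.trans h2
    rw [div_lt_iff₀ (by linarith)] at h3
    linarith

theorem theorem2 (n : ℕ) (hn : 4 ≤ n) :
    -- the integral defining `Φ` converges on `[0, 1]`
    (∀ ρ ∈ Set.Icc (0 : ℝ) 1,
      IntervalIntegrable (phiIntegrand n ρ) MeasureTheory.volume (-1) 1) ∧
    -- `Φ` is strictly concave on `(0, 1)`
    StrictConcaveOn ℝ (Set.Ioo (0 : ℝ) 1) (Phi n) ∧
    -- `Φ'(0) = 0`
    HasDerivAt (Phi n) 0 0 ∧
    -- `Φ` is strictly decreasing on `[0, 1]`, with maximum `Φ(0) = 2 / (n - 1)`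
    StrictAntiOn (Phi n) (Set.Icc (0 : ℝ) 1) ∧
    IsMaxOn (Phi n) (Set.Icc (0 : ℝ) 1) 0 ∧
    Phi n 0 = 2 / ((n : ℝ) - 1) := by
  obtain ⟨l, hl⟩ : ∃ l : ℝ, l = ((n : ℝ) - 2) / 2 := ⟨_, rfl⟩
  have hl1 : 1 ≤ l := by
    have : (4 : ℝ) ≤ n := by exact_mod_cast hn
    rw [hl]; linarith
  have hphi : ∀ ρ ∈ Ioc (-1 : ℝ) 1, Phi n ρ = phiClosed l (ρ ^ 2) := fun ρ hρ =>
    (intervalIntegrable_phiIntegrand_and_Phi_eq hn hl hρ).2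
  have hsub : Icc (0 : ℝ) 1 ⊆ Ioc (-1) 1 := fun ρ hρ => ⟨by linarith [hρ.1], hρ.2⟩
  have hconc : StrictConcaveOn ℝ (Icc (0 : ℝ) 1) (Phi n) :=
    (strictConcaveOn_phiClosed_sq hl1).congr fun ρ hρ => (hphi ρ (hsub hρ)).symm
  have hderiv : HasDerivAt (Phi n) 0 0 := by
    have h : HasDerivAt (phiClosed l) (deriv (phiClosed l) 0) ((0 : ℝ) ^ 2) := by
      rw [zero_pow two_ne_zero]
      exact (differentiableAt_phiClosed_zero hl1).hasDerivAt
    have h2 := HasDerivAt.comp (h := fun ρ : ℝ => ρ ^ 2) (0 : ℝ) h (hasDerivAt_pow 2 (0 : ℝ))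
    refine HasDerivAt.congr_of_eventuallyEq (h2.congr_deriv (by simp)) ?_
    filter_upwards [Ioo_mem_nhds (show (-1 : ℝ) < 0 by norm_num) one_pos] with ρ hρ
    exact hphi ρ ⟨hρ.1, hρ.2.le⟩
  have hanti := hconc.strictAntiOn_of_hasDerivAt_zero hderiv
  refine ⟨fun ρ hρ => (intervalIntegrable_phiIntegrand_and_Phi_eq hn hl (hsub hρ)).1,
    hconc.subset Ioo_subset_Icc_self (convex_Ioo _ _), hderiv, hanti, fun ρ hρ => ?_, ?_⟩
  · exact hanti.antitoneOn (left_mem_Icc.2 zero_le_one) hρ hρ.1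
  · rw [hphi 0 (by norm_num), zero_pow two_ne_zero, phiClosed_zero hl1, hl]
    congr 1
    ring
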